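/- Consider finite lattice paths in $\mathbb{Z}^2$ that start at $(0,0)$ and consist of unit north steps $N$ and unit east steps $E$. Let $v$ be such a path, and let $\mathrm{Tam}(v)$ be the set of all such paths that have the same endpoint as $v$ and lie weakly above $v$. For an integer point $p$ that lies weakly above $v$, let $\mathrm{horiz}_v(p)$ be the maximum number of east steps that can be added to the right of $p$ without crossing $v$. For $u,u'\in\mathrm{Tam}(v)$ write $u\to_v u'$ if $u'$ arises from $u$ as follows: choose an integer point $p$ on $u$ that is preceded by an east step $E$ and followed by a north step in $u$; let $p'$ be the first integer point of $u$ after $p$ with $\mathrm{horiz}_v(p')=\mathrm{horiz}_v(p)$; and switch the east step $E$ with the subpath $D_{[p,p']}$ of $u$ from $p$ to $p'$, that is, replace $E\,D_{[p,p']}$ by $D_{[p,p']}\,E$. Order $\mathrm{Tam}(v)$ by the reflexive and transitive closure $\leq_v$ of $\to_v$. **Theorem.** For every finite lattice path $v$ as above, $\leq_v$ is a partial order on $\mathrm{Tam}(v)$, and $(\mathrm{Tam}(v),\leq_v)$ is a lattice: any two elements have a least upper bound and a greatest lower bound. -/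

import Mathlib

/-- A unit step of a lattice path: north or east. -/
inductive LatticeStep : Type
  | N : LatticeStep
  | E : LatticeStep
  deriving DecidableEq

/-- A finite lattice path starting at `(0, 0)`, given as the list of its north and east steps. -/
abbrev LatticePath : Type := List LatticeStep

namespace LatticePath

open LatticeStep

/-- The end `(x, y)` of a path: `x` is the number of its east steps, `y` the number of its
north steps. The integer points lying on a path are the ends of its prefixes. -/
def endpoint (w : LatticePath) : ℕ × ℕ := (w.count E, w.count N)

/-- The point `p` lies weakly above (equivalently, weakly to the left of) the path `v`:
some integer point of `v` of the same height is weakly to the right of `p`. -/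
def PointAbove (v : LatticePath) (p : ℕ × ℕ) : Prop :=
  ∃ w : LatticePath, w <+: v ∧ (endpoint w).2 = p.2 ∧ p.1 ≤ (endpoint w).1

/-- The path `u` lies weakly above the path `v`: all integer points of `u` do. -/
def PathAbove (v u : LatticePath) : Prop :=
  ∀ w : LatticePath, w <+: u → PointAbove v (endpoint w)

/-- The horizontal distance of `p` from `v`: the maximal number of east steps which can be added
to the right of `p` without crossing `v`. For `p` weakly above `v` the set below
contains `0` and is bounded, so that the supremum is a maximum. -/
noncomputable def horiz (v : LatticePath) (p : ℕ × ℕ) : ℕ :=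
  sSup {k : ℕ | PointAbove v (p.1 + k, p.2)}

/-- `Switch v u u'`: the path `u` is `a E d c`, where `p` is the end of `a E` (so `p` is preceded
by an east step), `d` starts with a north step, the end `p'` of `a E d` is the first integer point
of `u` after `p` with the same horizontal distance from `v` as `p`, and `u' = a d E c` is
obtained from `u` by switching this east step and the subpath `d` from `p` to `p'`. -/
def Switch (v u u' : LatticePath) : Prop :=
  ∃ a d c : LatticePath,
    u = a ++ [E] ++ d ++ c ∧
    u' = a ++ d ++ [E] ++ c ∧
    [N] <+: d ∧
    horiz v (endpoint (a ++ [E] ++ d)) = horiz v (endpoint (a ++ [E])) ∧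
    ∀ w : LatticePath, w <+: d → w ≠ [] → w ≠ d →
      horiz v (endpoint (a ++ [E] ++ w)) ≠ horiz v (endpoint (a ++ [E]))

/-- The underlying set of `Tam(v)`: the paths from `(0, 0)` to the end of `v` that lie
weakly above `v`. -/
def Tam (v : LatticePath) : Type :=
  {u : LatticePath // endpoint u = endpoint v ∧ PathAbove v u}

/-- The order of `Tam(v)`: the reflexive and transitive closure of the switching relation. -/
def TamLE (v : LatticePath) : Tam v → Tam v → Prop :=
  Relation.ReflTransGen fun u u' : Tam v => Switch v u.1 u'.1

end LatticePath

namespace LatticePath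

open LatticeStep

/-! ### The rightmost point of a path at a given height -/

/-- The largest first coordinate of a point of `v` at height `y`. -/
def reach : LatticePath → ℕ → ℕ
  | [], _ => 0
  | E :: v, y => reach v y + 1
  | N :: _, 0 => 0
  | N :: v, y + 1 => reach v y

theorem reach_mono (v : LatticePath) : Monotone (reach v) := by
  refine monotone_nat_of_le_succ ?_
  induction v with
  | nil => intro y; simp [reach]
  | cons x v ih =>
    intro y
    cases x with
    | N => cases y with
      | zero => simp [reach]
      | succ y => simpa [reach] using ih y
    | E => simpa [reach] using ih y

theorem count_le_reach {v w : LatticePath} (h : w <+: v) :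
    w.count E ≤ reach v (w.count N) := by
  induction v generalizing w with
  | nil => simp_all
  | cons x v ih =>
    rcases List.prefix_cons_iff.1 h with rfl | ⟨t, rfl, ht⟩
    · simp
    · have := ih ht
      cases x <;> simp [reach] <;> omega

theorem reach_le_count (v : LatticePath) (y : ℕ) : reach v y ≤ v.count E := by
  induction v generalizing y with
  | nil => simp [reach]
  | cons x v ih =>
    cases x with
    | N => cases y with
      | zero => simp [reach]
      | succ y => simpa [reach] using ih y
    | E => simpa [reach] using ih y

theorem reach_count (v : LatticePath) : reach v (v.count N) = v.count E :=
  (reach_le_count v _).antisymm (count_le_reach List.prefix_rfl)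

theorem exists_prefix_reach {v : LatticePath} {y : ℕ} (h : y ≤ v.count N) :
    ∃ w, w <+: v ∧ w.count N = y ∧ w.count E = reach v y := by
  induction v generalizing y with
  | nil => exact ⟨[], by simp_all [reach]⟩
  | cons x v ih =>
    cases x with
    | N => cases y with
      | zero => exact ⟨[], by simp [reach]⟩
      | succ y =>
        obtain ⟨w, h1, h2, h3⟩ := ih (y := y) (by simpa using h)
        exact ⟨N :: w, by simpa using h1, by simpa using h2, by simpa [reach] using h3⟩
    | E =>
      obtain ⟨w, h1, h2, h3⟩ := ih (y := y) (by simpa using h)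
      exact ⟨E :: w, by simpa using h1, by simpa using h2, by simpa [reach] using h3⟩

theorem pointAbove_iff {v : LatticePath} {x y : ℕ} :
    PointAbove v (x, y) ↔ y ≤ v.count N ∧ x ≤ reach v y := by
  constructor
  · rintro ⟨w, hw, h1, h2⟩
    simp only [endpoint] at h1 h2
    subst h1
    exact ⟨hw.sublist.count_le _, h2.trans (count_le_reach hw)⟩
  · rintro ⟨h1, h2⟩
    obtain ⟨w, hw, h3, h4⟩ := exists_prefix_reach h1
    exact ⟨w, hw, h3, by simpa [endpoint, h4] using h2⟩

theorem horiz_eq {v : LatticePath} {x y : ℕ} (h : PointAbove v (x, y)) :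
    horiz v (x, y) = reach v y - x := by
  rw [pointAbove_iff] at h
  have : {k : ℕ | PointAbove v (x + k, y)} = Set.Iic (reach v y - x) := by
    ext k
    simp only [Set.mem_ofPred_eq, pointAbove_iff, Set.mem_Iic]
    omega
  simp only [horiz, this, csSup_Iic]

/-! ### The stack of open columns along a path

A north step to height `y + 1` pushes the columns from `R y` to `R (y + 1)`, an east step pops
the last column that is still open. -/

section Stack

variable (R : ℕ → ℕ)

/-- The columns that become available at height `y + 1`, in decreasing order. -/
def newCols (y : ℕ) : List ℕ := (List.range' (R y) (R (y + 1) - R y)).reverse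

/-- The open columns after the steps `w`, from the open columns `S` at height `y`. -/
def stack : ℕ → List ℕ → LatticePath → List ℕ
  | _, S, [] => S
  | y, S, N :: w => stack (y + 1) (newCols R y ++ S) w
  | y, _ :: S, E :: w => stack y S w
  -- Junk case: `Safe` excludes an east step on the empty stack.
  | y, [], E :: w => stack y [] w

/-- The bracket vector of the steps `w`: the heights at which the columns are closed. -/
def bracket : ℕ → List ℕ → LatticePath → ℕ → ℕ
  | _, _, [] => 0
  | y, S, N :: w => bracket (y + 1) (newCols R y ++ S) w
  | y, j :: S, E :: w => Pi.single j y + bracket y S w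
  | y, [], E :: w => bracket y [] w

/-- With `k` open columns at height `y`, no east step of `w` meets an empty stack. -/
def Safe (y k : ℕ) (w : LatticePath) : Prop :=
  ∀ t, t <+: w → t.count E + R y ≤ k + R (y + t.count N)

/-- Open columns at height `y` are listed in decreasing order. -/
def IsStack (y : ℕ) (S : List ℕ) : Prop :=
  S.Pairwise (· > ·) ∧ ∀ j ∈ S, j < R y

variable {R}

/-! ### Stacks along safe paths -/

theorem mem_newCols {y j : ℕ} : j ∈ newCols R y ↔ R y ≤ j ∧ j < R (y + 1) := by
  simp only [newCols, List.mem_reverse, List.mem_range'_1]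
  omega

theorem length_newCols (y : ℕ) : (newCols R y).length = R (y + 1) - R y := by
  simp [newCols]

theorem IsStack.north (hR : Monotone R) {y : ℕ} {S : List ℕ} (h : IsStack R y S) :
    IsStack R (y + 1) (newCols R y ++ S) := by
  refine ⟨List.pairwise_append.2 ⟨?_, h.1, ?_⟩, ?_⟩
  · rw [newCols, List.pairwise_reverse]
    exact List.pairwise_lt_range'
  · intro a ha b hb
    exact (h.2 b hb).trans_le (mem_newCols.1 ha).1
  · intro j hj
    rcases List.mem_append.1 hj with hj | hj
    · exact (mem_newCols.1 hj).2
    · exact (h.2 j hj).trans_le (hR y.le_succ)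

theorem IsStack.east {y j : ℕ} {S : List ℕ} (h : IsStack R y (j :: S)) : IsStack R y S :=
  ⟨(List.pairwise_cons.1 h.1).2, fun i hi => h.2 i (List.mem_cons_of_mem _ hi)⟩

theorem IsStack.lt_head {y j i : ℕ} {S : List ℕ} (h : IsStack R y (j :: S)) (hi : i ∈ S) : i < j :=
  (List.pairwise_cons.1 h.1).1 i hi

theorem IsStack.head_notMem {y j : ℕ} {S : List ℕ} (h : IsStack R y (j :: S)) : j ∉ S :=
  fun hj => (h.lt_head hj).false

theorem Safe.north (hR : Monotone R) {y : ℕ} {S : List ℕ} {w : LatticePath}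
    (h : Safe R y S.length (N :: w)) : Safe R (y + 1) (newCols R y ++ S).length w := by
  intro t ht
  have := h (N :: t) (by simpa using ht)
  have h1 := hR y.le_succ
  have h2 : y + (N :: t).count N = y + 1 + t.count N := by simp; omega
  rw [h2] at this
  simp only [List.length_append, length_newCols, Nat.succ_eq_add_one] at h1 ⊢
  simp at this
  omega

theorem Safe.ne_nil {y : ℕ} {S : List ℕ} {w : LatticePath}
    (h : Safe R y S.length (E :: w)) : S ≠ [] := by
  rintro rfl
  have := h [E] (by simp)
  simp at this

theorem Safe.east {y j : ℕ} {S : List ℕ} {w : LatticePath}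
    (h : Safe R y (j :: S).length (E :: w)) : Safe R y S.length w := by
  intro t ht
  have := h (E :: t) (by simpa using ht)
  simp at this
  omega

theorem Safe.of_prefix {y k : ℕ} {w t : LatticePath} (h : Safe R y k w) (ht : t <+: w) :
    Safe R y k t :=
  fun s hs => h s (hs.trans ht)

/-- Induction along a safe path. -/
theorem Safe.induction (hR : Monotone R) {motive : ℕ → List ℕ → LatticePath → Prop}
    (nil : ∀ y S, IsStack R y S → motive y S [])
    (north : ∀ y S w, IsStack R y S → Safe R y S.length (N :: w) →
      motive (y + 1) (newCols R y ++ S) w → motive y S (N :: w))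
    (east : ∀ y j S w, IsStack R y (j :: S) → Safe R y (j :: S).length (E :: w) →
      motive y S w → motive y (j :: S) (E :: w))
    {y : ℕ} {S : List ℕ} {w : LatticePath} (hS : IsStack R y S) (hw : Safe R y S.length w) :
    motive y S w := by
  induction w generalizing y S with
  | nil => exact nil y S hS
  | cons x w ih =>
    cases x with
    | N => exact north y S w hS hw (ih (hS.north hR) (hw.north hR))
    | E =>
      cases S with
      | nil => exact absurd rfl hw.ne_nil
      | cons j S => exact east y j S w hS hw (ih hS.east hw.east)

/-- Singles out the last point of `d` at a given height, the one just before the next north step. -/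
theorem exists_prefix_append_north {d : LatticePath} {k : ℕ} (h : k < d.count N) :
    ∃ w, w ++ [N] <+: d ∧ w.count N = k := by
  induction d generalizing k with
  | nil => simp at h
  | cons x d ih =>
    cases x with
    | N => cases k with
      | zero => exact ⟨[], by simp⟩
      | succ k =>
        obtain ⟨w, h1, h2⟩ := ih (k := k) (by simpa using h)
        exact ⟨N :: w, by simpa using h1, by simpa using h2⟩
    | E =>
      obtain ⟨w, h1, h2⟩ := ih (k := k) (by simpa using h)
      exact ⟨E :: w, by simpa using h1, by simpa using h2⟩

theorem stack_append (y : ℕ) (S : List ℕ) (w t : LatticePath) :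
    stack R y S (w ++ t) = stack R (y + w.count N) (stack R y S w) t := by
  induction w generalizing y S with
  | nil => simp [stack]
  | cons x w ih =>
    cases x with
    | N => simp [stack, ih, add_assoc, add_comm 1]
    | E => cases S <;> simp [stack, ih]

theorem bracket_append (y : ℕ) (S : List ℕ) (w t : LatticePath) :
    bracket R y S (w ++ t) =
      bracket R y S w + bracket R (y + w.count N) (stack R y S w) t := by
  induction w generalizing y S with
  | nil => simp [stack, bracket]
  | cons x w ih =>
    cases x with
    | N => simp [stack, bracket, ih, add_assoc, add_comm 1]
    | E => cases S <;> simp [stack, bracket, ih, add_assoc]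

/-- Conservation law: pushes are counted by the growth of `R`, pops by east steps. Started from the
initial stack of v, it identifies the stack length with the horizontal distance. -/
theorem length_stack (hR : Monotone R) {y : ℕ} {S : List ℕ} {w : LatticePath}
    (hS : IsStack R y S) (hw : Safe R y S.length w) :
    (stack R y S w).length + w.count E + R y = S.length + R (y + w.count N) := by
  refine Safe.induction hR (motive := fun y S w =>
    (stack R y S w).length + w.count E + R y = S.length + R (y + w.count N)) ?_ ?_ ?_ hS hw
  · intro y S _; simp [stack]
  · intro y S w _ _ ih
    have h1 := hR y.le_succ
    simp only [stack, List.length_append, length_newCols, Nat.succ_eq_add_one] at ih h1 ⊢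
    have h2 : y + (N :: w).count N = y + 1 + w.count N := by simp; omega
    rw [h2]
    simp
    omega
  · intro y j S w _ _ ih
    simp [stack]
    omega

theorem Safe.right (hR : Monotone R) {y : ℕ} {S : List ℕ} {w t : LatticePath}
    (hS : IsStack R y S) (h : Safe R y S.length (w ++ t)) :
    Safe R (y + w.count N) (stack R y S w).length t := by
  intro s hs
  have h1 := length_stack hR hS (h.of_prefix (List.prefix_append w t))
  have h2 := h (w ++ s) (by simpa using hs)
  simp only [List.count_append, ← add_assoc] at h2
  omega

theorem isStack_stack (hR : Monotone R) {y : ℕ} {S : List ℕ} {w : LatticePath}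
    (hS : IsStack R y S) (hw : Safe R y S.length w) :
    IsStack R (y + w.count N) (stack R y S w) := by
  refine Safe.induction hR (motive := fun y S w =>
    IsStack R (y + w.count N) (stack R y S w)) ?_ ?_ ?_ hS hw
  · intro y S h; simpa [stack] using h
  · intro y S w _ _ ih
    simpa [stack, add_assoc, add_comm 1] using ih
  · intro y j S w _ _ ih
    simpa [stack] using ih

/-- Columns below a safe path play no role. -/
theorem stack_bracket_append_stack (hR : Monotone R) {y : ℕ} {S : List ℕ} {w : LatticePath}
    (hS : IsStack R y S) (hw : Safe R y S.length w) (X : List ℕ) :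
    stack R y (S ++ X) w = stack R y S w ++ X ∧ bracket R y (S ++ X) w = bracket R y S w := by
  refine Safe.induction hR (motive := fun y S w =>
    stack R y (S ++ X) w = stack R y S w ++ X ∧ bracket R y (S ++ X) w = bracket R y S w)
    ?_ ?_ ?_ hS hw
  · intro y S h; simp [stack, bracket]
  · intro y S w _ _ ih
    simpa [stack, bracket] using ih
  · intro y j S w _ _ ih
    simpa [stack, bracket] using ih

/-! ### Bracket vectors of safe paths -/

/-- Such a column is never on the stack along `w`. In particular a popped column never returns, so
its entry is settled by that single pop. -/
theorem bracket_eq_zero (hR : Monotone R) {y : ℕ} {S : List ℕ} {w : LatticePath}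
    (hS : IsStack R y S) (hw : Safe R y S.length w) {j : ℕ} (hj : j ∉ S)
    (h : j < R y ∨ R (y + w.count N) ≤ j) : bracket R y S w j = 0 := by
  refine Safe.induction hR (motive := fun y S w => j ∉ S → (j < R y ∨ R (y + w.count N) ≤ j) →
    bracket R y S w j = 0) ?_ ?_ ?_ hS hw hj h
  · intro y S _ _ _; rfl
  · intro y S w _ _ ih hj h
    have h1 := hR y.le_succ
    have h2 : y + (N :: w).count N = y + 1 + w.count N := by simp; omega
    have h3 := hR (show y + 1 ≤ y + 1 + w.count N by omega)
    rw [h2] at h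
    refine ih ?_ ?_
    · simp only [List.mem_append, mem_newCols, Nat.succ_eq_add_one] at *
      rintro (h4 | h4)
      · omega
      · exact hj h4
    · simp only [Nat.succ_eq_add_one] at *
      omega
  · intro y i S w _ _ ih hj h
    rw [List.mem_cons, not_or] at hj
    simp only [bracket, Pi.add_apply, Pi.single_eq_of_ne hj.1, zero_add]
    exact ih hj.2 (by simpa using h)

theorem bracket_le (hR : Monotone R) {y : ℕ} {S : List ℕ} {w : LatticePath}
    (hS : IsStack R y S) (hw : Safe R y S.length w) (j : ℕ) :
    bracket R y S w j ≤ y + w.count N := by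
  refine Safe.induction hR (motive := fun y S w =>
    bracket R y S w j ≤ y + w.count N) ?_ ?_ ?_ hS hw
  · intro y S _; simp [bracket]
  · intro y S w _ _ ih
    simp only [bracket, List.count_cons_self]
    omega
  · intro y i S w hS hw ih
    by_cases hj : j = i
    · subst hj
      simp [bracket, bracket_eq_zero hR hS.east hw.east hS.head_notMem
        (Or.inl (hS.2 j List.mem_cons_self))]
    · simpa [bracket, Pi.single_eq_of_ne hj] using ih

/-- A column that is open now and closed at the end is closed at a height at which it is
available. -/
theorem le_bracket (hR : Monotone R) {y : ℕ} {S : List ℕ} {w : LatticePath}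
    (hS : IsStack R y S) (hw : Safe R y S.length w) (hnil : stack R y S w = []) {j : ℕ}
    (hj : j ∈ S ∨ R y ≤ j ∧ j < R (y + w.count N)) :
    y ≤ bracket R y S w j ∧ j < R (bracket R y S w j) := by
  refine Safe.induction hR (motive := fun y S w => stack R y S w = [] →
    (j ∈ S ∨ R y ≤ j ∧ j < R (y + w.count N)) →
    y ≤ bracket R y S w j ∧ j < R (bracket R y S w j)) ?_ ?_ ?_ hS hw hnil hj
  · intro y S _ h hj
    simp only [stack] at h
    subst h
    simp at hj
    omega
  · intro y S w _ _ ih h hj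
    simp only [stack] at h
    have h2 : y + (N :: w).count N = y + 1 + w.count N := by simp; omega
    rw [h2] at hj
    have := ih h (by
      simp only [List.mem_append, mem_newCols]
      by_cases hjS : j ∈ S
      · simp [hjS]
      · have := hj.resolve_left hjS
        omega)
    simp only [bracket]
    exact ⟨by omega, this.2⟩
  · intro y i S w hS hw ih h hj
    by_cases hji : j = i
    · subst hji
      have hlt := hS.2 j List.mem_cons_self
      simpa [bracket, bracket_eq_zero hR hS.east hw.east hS.head_notMem (Or.inl hlt)] using hlt
    · simp only [bracket, Pi.add_apply, Pi.single_eq_of_ne hji, zero_add]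
      exact ih h (by simpa [hji] using hj)

/-- The stack is decreasing, so a larger column that becomes available while `i` is open sits above
`i` and must be popped before it. -/
theorem bracket_laminar (hR : Monotone R) {y : ℕ} {S : List ℕ} {w : LatticePath}
    (hS : IsStack R y S) (hw : Safe R y S.length w) (hnil : stack R y S w = []) {i j : ℕ}
    (hi : i ∈ S ∨ R y ≤ i ∧ i < R (y + w.count N))
    (hj : j ∈ S ∨ R y ≤ j ∧ j < R (y + w.count N)) (hij : i < j)
    (h : j < R (bracket R y S w i)) : bracket R y S w j ≤ bracket R y S w i := by
  refine Safe.induction hR (motive := fun y S w => stack R y S w = [] →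
    (i ∈ S ∨ R y ≤ i ∧ i < R (y + w.count N)) → (j ∈ S ∨ R y ≤ j ∧ j < R (y + w.count N)) →
    j < R (bracket R y S w i) → bracket R y S w j ≤ bracket R y S w i) ?_ ?_ ?_ hS hw hnil hi hj h
  · intro y S _ h hi hj _
    simp [bracket]
  · intro y S w _ _ ih h hi hj hlt
    simp only [stack] at h
    have h2 : y + (N :: w).count N = y + 1 + w.count N := by simp; omega
    rw [h2] at hi hj
    refine ih h ?_ ?_ hlt
    · simp only [List.mem_append, mem_newCols]
      by_cases hjS : i ∈ S
      · simp [hjS]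
      · have := hi.resolve_left hjS
        omega
    · simp only [List.mem_append, mem_newCols]
      by_cases hjS : j ∈ S
      · simp [hjS]
      · have := hj.resolve_left hjS
        omega
  · intro y k S w hS hw ih h hi hj hlt
    have hk := hS.2 k List.mem_cons_self
    have hk0 := bracket_eq_zero hR hS.east hw.east hS.head_notMem (Or.inl hk)
    by_cases hik : i = k
    · subst hik
      have hjne : j ≠ i := hij.ne'
      simp only [bracket, Pi.add_apply, Pi.single_eq_same, hk0, add_zero,
        Pi.single_eq_of_ne hjne, zero_add] at hlt ⊢
      simp only [List.mem_cons, hjne, false_or] at hj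
      rcases hj with hj | hj
      · exact absurd (hS.lt_head hj) (by omega)
      · omega
    · simp only [List.mem_cons, hik, false_or] at hi
      have h1 := le_bracket hR hS.east hw.east h (j := i) (by simpa using hi)
      simp only [bracket, Pi.add_apply, Pi.single_eq_of_ne hik, zero_add] at hlt ⊢
      by_cases hjk : j = k
      · subst hjk
        simp only [Pi.single_eq_same, hk0, add_zero]
        exact h1.1
      · simp only [Pi.single_eq_of_ne hjk, zero_add]
        exact ih h (by simpa using hi) (by simpa [hjk] using hj) hlt

/-- Where two paths first differ, the one stepping east pops the top column at the current height
`y`; the one stepping north can pop it only at height `y + 1` or later. -/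
theorem bracket_injective (hR : Monotone R) {y : ℕ} {S : List ℕ} {w t : LatticePath}
    (hS : IsStack R y S) (hw : Safe R y S.length w) (ht : Safe R y S.length t)
    (hwnil : stack R y S w = []) (htnil : stack R y S t = []) (hN : w.count N = t.count N)
    (hE : w.count E = t.count E) (h : bracket R y S w = bracket R y S t) : w = t := by
  induction w generalizing y S t with
  | nil => cases t with
    | nil => rfl
    | cons x t => cases x <;> simp at hN hE
  | cons x w ih =>
    have key : ∀ {k S w t}, IsStack R y (k :: S) → Safe R y (k :: S).length (E :: w) →
        Safe R y (k :: S).length (N :: t) → stack R y (k :: S) (N :: t) = [] →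
        bracket R y (k :: S) (E :: w) ≠ bracket R y (k :: S) (N :: t) := by
      intro k S w t hS hw ht htnil h
      have h0 := bracket_eq_zero hR hS.east hw.east hS.head_notMem
        (Or.inl (hS.2 k List.mem_cons_self))
      have h1 := (le_bracket hR (hS.north hR) (ht.north hR) htnil (j := k) (by simp)).1
      have h2 := congrFun h k
      simp only [bracket, Pi.add_apply, Pi.single_eq_same, h0] at h2
      omega
    cases t with
    | nil => cases x <;> simp at hN hE
    | cons x' t =>
      cases x <;> cases x'
      · rw [ih (hS.north hR) (hw.north hR) (ht.north hR) hwnil htnil (by simpa using hN)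
          (by simpa using hE) h]
      · obtain ⟨k, S, rfl⟩ := List.exists_cons_of_ne_nil ht.ne_nil
        exact absurd h.symm (key hS ht hw hwnil)
      · obtain ⟨k, S, rfl⟩ := List.exists_cons_of_ne_nil hw.ne_nil
        exact absurd h (key hS hw ht htnil)
      · obtain ⟨k, S, rfl⟩ := List.exists_cons_of_ne_nil hw.ne_nil
        rw [ih hS.east hw.east ht.east hwnil htnil (by simpa using hN)
          (by simpa using hE) (add_left_cancel h)]

/-- Every column is closed by some east step. -/
theorem exists_closing_step (hR : Monotone R) {y : ℕ} {S : List ℕ} {w : LatticePath}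
    (hS : IsStack R y S) (hw : Safe R y S.length w) (hnil : stack R y S w = []) {j : ℕ}
    (hj : j ∈ S ∨ R y ≤ j ∧ j < R (y + w.count N)) :
    ∃ a c s, w = a ++ E :: c ∧ stack R y S a = j :: s ∧
      bracket R y S w j = y + a.count N := by
  refine Safe.induction hR (motive := fun y S w => stack R y S w = [] →
    (j ∈ S ∨ R y ≤ j ∧ j < R (y + w.count N)) →
    ∃ a c s, w = a ++ E :: c ∧ stack R y S a = j :: s ∧
      bracket R y S w j = y + a.count N) ?_ ?_ ?_ hS hw hnil hj
  · intro y S _ h hj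
    simp only [stack] at h
    subst h
    simp at hj
    omega
  · intro y S w _ _ ih h hj
    simp only [stack] at h
    have h2 : y + (N :: w).count N = y + 1 + w.count N := by simp; omega
    rw [h2] at hj
    obtain ⟨a, c, s, rfl, h3, h4⟩ := ih h (by
      simp only [List.mem_append, mem_newCols]
      by_cases hjS : j ∈ S
      · simp [hjS]
      · have := hj.resolve_left hjS
        omega)
    refine ⟨N :: a, c, s, rfl, h3, ?_⟩
    simp only [bracket, h4, List.count_cons_self]
    omega
  · intro y i S w hS hw ih h hj
    by_cases hji : j = i
    · subst hji
      have hlt := hS.2 j List.mem_cons_self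
      refine ⟨[], w, S, rfl, rfl, ?_⟩
      simp [bracket, bracket_eq_zero hR hS.east hw.east hS.head_notMem (Or.inl hlt)]
    · obtain ⟨a, c, s, rfl, h3, h4⟩ := ih h (by simpa [hji] using hj)
      refine ⟨E :: a, c, s, rfl, h3, ?_⟩
      simpa [bracket, Pi.single_eq_of_ne hji] using h4

/-- Moving an east step past a balanced path raises one entry of the bracket vector. -/
theorem bracket_switch (hR : Monotone R) {y : ℕ} {S s : List ℕ} {a d c : LatticePath} {i : ℕ}
    (ha : stack R y S a = i :: s) (hd : Safe R (y + a.count N) 0 d)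
    (hbal : d.count E + R (y + a.count N) = R (y + a.count N + d.count N)) :
    bracket R y S (a ++ d ++ [E] ++ c) =
      bracket R y S (a ++ [E] ++ d ++ c) + Pi.single i (d.count N) := by
  have hnil : IsStack R (y + a.count N) [] := ⟨List.Pairwise.nil, by simp⟩
  have h0 : stack R (y + a.count N) [] d = [] := by
    have := length_stack hR hnil hd
    rw [← List.length_eq_zero_iff]
    simp at this
    omega
  -- From an empty stack `d` returns to an empty stack, so it acts in the same way whether `i` still
  -- lies underneath or not.
  have h1 := stack_bracket_append_stack hR hnil hd s
  have h2 := stack_bracket_append_stack hR hnil hd (i :: s)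
  simp only [List.nil_append, h0] at h1 h2
  simp only [List.append_assoc, bracket_append, ha, h2.1, h2.2, List.cons_append,
    List.nil_append, bracket, h1.1, h1.2, Pi.single_add]
  abel

end Stack

/-- The first return to the initial distance after a north step. -/
theorem exists_first_return {R : ℕ → ℕ} (hR : Monotone R) {y : ℕ} {r : LatticePath}
    (h : R (y + (N :: r).count N) ≤ (N :: r).count E + R y) :
    ∃ d c, N :: r = d ++ c ∧ [N] <+: d ∧ d.count E + R y = R (y + d.count N) ∧
      ∀ w, w <+: d → w ≠ [] → w ≠ d → w.count E + R y < R (y + w.count N) := by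
  -- Extend the prefix `b` one step at a time. An east step lowers the distance by exactly one, so
  -- the initial value cannot be skipped.
  suffices H : ∀ r b : LatticePath, [N] <+: b → b.count E + R y ≤ R (y + b.count N) →
      (∀ w, w <+: b → w ≠ [] → w ≠ b → w.count E + R y < R (y + w.count N)) →
      R (y + (b ++ r).count N) ≤ (b ++ r).count E + R y →
      ∃ d c, b ++ r = d ++ c ∧ [N] <+: d ∧ d.count E + R y = R (y + d.count N) ∧
        ∀ w, w <+: d → w ≠ [] → w ≠ d → w.count E + R y < R (y + w.count N) by
    refine H r [N] List.prefix_rfl ?_ ?_ h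
    · simpa using hR y.le_succ
    · intro w hw h1 h2
      rcases List.prefix_cons_iff.1 hw with rfl | ⟨t, rfl, ht⟩
      · exact absurd rfl h1
      · simp_all
  intro r
  induction r with
  | nil =>
    intro b hb h1 h2 h3
    exact ⟨b, [], rfl, hb, by simp only [List.append_nil] at h3; omega, h2⟩
  | cons x r ih =>
    intro b hb h1 h2 h3
    rcases h1.eq_or_lt with h1 | h1
    · exact ⟨b, x :: r, rfl, hb, h1, h2⟩
    · rw [List.append_cons] at h3 ⊢
      refine ih (b ++ [x]) (hb.trans (List.prefix_append _ _)) ?_ ?_ h3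
      · cases x with
        | N =>
          have := hR (show y + b.count N ≤ y + (b.count N + 1) by omega)
          simp
          omega
        | E =>
          simp
          omega
      · intro w hw hw1 hw2
        rcases List.prefix_concat_iff.1 hw with rfl | hw
        · exact absurd rfl hw2
        · by_cases hwb : w = b
          · rwa [hwb]
          · exact h2 w hw hw1 hwb

/-! ### Bracket vectors of `Tam v` -/

section Tam

variable {v : LatticePath}

theorem pathAbove_iff {u : LatticePath} : PathAbove v u ↔
    ∀ w, w <+: u → w.count N ≤ v.count N ∧ w.count E ≤ reach v (w.count N) :=
  forall₂_congr fun _ _ => pointAbove_iff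

/-- The columns available at height `0`. -/
def initialStack (v : LatticePath) : List ℕ := (List.range (reach v 0)).reverse

theorem mem_initialStack {j : ℕ} : j ∈ initialStack v ↔ j < reach v 0 := by
  simp [initialStack]

theorem length_initialStack : (initialStack v).length = reach v 0 := by
  simp [initialStack]

theorem isStack_initialStack : IsStack (reach v) 0 (initialStack v) := by
  refine ⟨?_, fun j hj => mem_initialStack.1 hj⟩
  rw [initialStack, List.pairwise_reverse]
  exact List.pairwise_lt_range

/-- The bracket vector of an element of `Tam v`. -/
def bracketVector (u : Tam v) : ℕ → ℕ := bracket (reach v) 0 (initialStack v) u.1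

namespace Tam

theorem count_N (u : Tam v) : u.1.count N = v.count N := congrArg Prod.snd u.2.1

theorem count_E (u : Tam v) : u.1.count E = v.count E := congrArg Prod.fst u.2.1

theorem safe (u : Tam v) : Safe (reach v) 0 (initialStack v).length u.1 := by
  intro t ht
  have := (pathAbove_iff.1 u.2.2 t ht).2
  simp only [length_initialStack, zero_add]
  omega

theorem length_stack (u : Tam v) {w : LatticePath} (hw : w <+: u.1) :
    (stack (reach v) 0 (initialStack v) w).length + w.count E = reach v (w.count N) := by
  have := LatticePath.length_stack (reach_mono v) isStack_initialStack (u.safe.of_prefix hw)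
  simp only [length_initialStack, zero_add] at this
  omega

theorem stack_eq_nil (u : Tam v) : stack (reach v) 0 (initialStack v) u.1 = [] := by
  have := u.length_stack List.prefix_rfl
  rw [u.count_N, u.count_E, reach_count] at this
  rw [← List.length_eq_zero_iff]
  omega

theorem available (u : Tam v) {j : ℕ} (hj : j < v.count E) :
    j ∈ initialStack v ∨ reach v 0 ≤ j ∧ j < reach v (0 + u.1.count N) := by
  rw [u.count_N, zero_add, reach_count, mem_initialStack]
  omega

theorem horiz_eq (u : Tam v) {w : LatticePath} (hw : w <+: u.1) :
    horiz v (endpoint w) = reach v (w.count N) - w.count E :=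
  LatticePath.horiz_eq (u.2.2 w hw)

end Tam

/-- The bracket vectors over `v`: the intervals from the height at which a column becomes
available to the height at which it is closed are nested or disjoint. -/
structure IsBracketVector (v : LatticePath) (b : ℕ → ℕ) : Prop where
  eq_zero : ∀ j, v.count E ≤ j → b j = 0
  le_count : ∀ j, b j ≤ v.count N
  lt_reach : ∀ j < v.count E, j < reach v (b j)
  laminar : ∀ i j, i < j → j < v.count E → j < reach v (b i) → b j ≤ b i

theorem isBracketVector_bracketVector (u : Tam v) : IsBracketVector v (bracketVector u) where
  eq_zero j hj := by
    have := reach_le_count v 0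
    refine bracket_eq_zero (reach_mono v) isStack_initialStack u.safe ?_ (Or.inr ?_)
    · rw [mem_initialStack]
      omega
    · rwa [u.count_N, zero_add, reach_count]
  le_count j := by
    have := bracket_le (reach_mono v) isStack_initialStack u.safe j
    rwa [zero_add, u.count_N] at this
  lt_reach j hj :=
    (le_bracket (reach_mono v) isStack_initialStack u.safe u.stack_eq_nil (u.available hj)).2
  laminar i j hij hj h :=
    bracket_laminar (reach_mono v) isStack_initialStack u.safe u.stack_eq_nil
      (u.available (hij.trans hj)) (u.available hj) hij h

theorem bracketVector_injective : Function.Injective (bracketVector (v := v)) := fun u t h =>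
  Subtype.ext <| bracket_injective (reach_mono v) isStack_initialStack u.safe t.safe
    u.stack_eq_nil t.stack_eq_nil (u.count_N.trans t.count_N.symm)
    (u.count_E.trans t.count_E.symm) h

/-- The bottom element `v` of `Tam v`. -/
def Tam.bot (v : LatticePath) : Tam v :=
  ⟨v, rfl, pathAbove_iff.2 fun _ hw => ⟨hw.sublist.count_le _, count_le_reach hw⟩⟩

/-- At the rightmost point of v at height `b j` the stack is empty. Column `j` is available there,
hence already popped. -/
theorem bracketVector_bot_le {b : ℕ → ℕ} (hb : IsBracketVector v b) :
    bracketVector (Tam.bot v) ≤ b := by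
  intro j
  rcases le_or_gt (v.count E) j with hj | hj
  · rw [(isBracketVector_bracketVector _).eq_zero j hj]
    exact Nat.zero_le _
  obtain ⟨w, ⟨t, hwt⟩, h1, h2⟩ := exists_prefix_reach (hb.le_count j)
  have hw : w <+: (Tam.bot v).1 := ⟨t, hwt⟩
  have hnil : stack (reach v) 0 (initialStack v) w = [] := by
    have := (Tam.bot v).length_stack hw
    rw [h1, h2] at this
    rw [← List.length_eq_zero_iff]
    omega
  have hsafe : Safe (reach v) (b j) ([] : List ℕ).length t := by
    intro s hs
    have h3 : w ++ s <+: v := by rw [← hwt]; simpa using hs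
    have := count_le_reach h3
    simp only [List.count_append, h1, h2] at this
    simp only [List.length_nil]
    omega
  have h3 : bracketVector (Tam.bot v) = bracket (reach v) 0 (initialStack v) (w ++ t) := by
    rw [hwt]; rfl
  have h4 := bracket_le (reach_mono v) isStack_initialStack
    ((Tam.bot v).safe.of_prefix hw) j
  have h5 := bracket_eq_zero (reach_mono v) ⟨List.Pairwise.nil, by simp⟩ hsafe
    (j := j) (by simp) (Or.inl (hb.lt_reach j hj))
  rw [h3, bracket_append, hnil, Pi.add_apply, h1, zero_add, h5, add_zero]
  simpa [h1] using h4

/-! ### Switches and the componentwise order -/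

theorem prefix_append_iff {w a c : LatticePath} :
    w <+: a ++ c ↔ w <+: a ∨ ∃ s, w = a ++ s ∧ s <+: c := by
  constructor
  · intro h
    rcases le_total w.length a.length with hl | hl
    · exact Or.inl (List.prefix_of_prefix_length_le h (List.prefix_append _ _) hl)
    · obtain ⟨s, rfl⟩ := List.prefix_of_prefix_length_le (List.prefix_append a c) h hl
      exact Or.inr ⟨s, rfl, (List.prefix_append_right_inj a).1 h⟩
  · rintro (h | ⟨s, rfl, h⟩)
    · exact h.trans (List.prefix_append _ _)
    · exact (List.prefix_append_right_inj a).2 h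

/-- The path obtained by moving an east step past a balanced path is in `Tam v`. -/
theorem mem_tam_of_switch {a d c : LatticePath}
    (h : endpoint (a ++ [E] ++ d ++ c) = endpoint v ∧ PathAbove v (a ++ [E] ++ d ++ c)) :
    endpoint (a ++ d ++ [E] ++ c) = endpoint v ∧ PathAbove v (a ++ d ++ [E] ++ c) := by
  obtain ⟨h1, h2⟩ := h
  refine ⟨?_, ?_⟩
  · rw [← h1]
    simp [endpoint]
    omega
  · rw [pathAbove_iff] at h2 ⊢
    intro w hw
    have hw' : w <+: a ++ (d ++ ([E] ++ c)) := by simpa using hw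
    rcases prefix_append_iff.1 hw' with hw | ⟨s, rfl, hs⟩
    · exact h2 w (hw.trans (by simp))
    -- Points along `d` move one unit west, which keeps them above v; later points do not move.
    · rcases prefix_append_iff.1 hs with hs | ⟨s, rfl, hs'⟩
      · have := h2 (a ++ [E] ++ s) (by
          simpa using hs.trans (List.prefix_append _ _))
        simp at this ⊢
        omega
      · rcases List.prefix_cons_iff.1 hs' with rfl | ⟨s, rfl, hs⟩
        · have := h2 (a ++ [E] ++ d) (by simp)
          simp at this ⊢
          omega
        · have := h2 (a ++ [E] ++ d ++ s) (by simpa using hs)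
          simp at this ⊢
          omega

theorem bracketVector_le_of_switch {u t : Tam v} (h : Switch v u.1 t.1) :
    bracketVector u ≤ bracketVector t := by
  obtain ⟨a, d, c, hu, ht, hN, hret, hfirst⟩ := h
  have hR := reach_mono v
  have hpre : ∀ w, w <+: d → a ++ [E] ++ w <+: u.1 := by
    intro w hw
    rw [hu]
    simpa using hw.trans (List.prefix_append _ _)
  have hle : ∀ w, w <+: d → w.count E + a.count E + 1 ≤ reach v (a.count N + w.count N) := by
    intro w hw
    have := (pathAbove_iff.1 u.2.2 _ (hpre w hw)).2
    simp at this
    omega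
  have hhoriz : ∀ w, w <+: d → horiz v (endpoint (a ++ [E] ++ w)) =
      reach v (a.count N + w.count N) - (w.count E + a.count E + 1) := by
    intro w hw
    rw [u.horiz_eq (hpre w hw)]
    simp
    omega
  have hnil : List.nil <+: d := List.nil_prefix
  have hle0 := hle [] hnil
  have h0 := hhoriz [] hnil
  simp only [List.append_nil, List.count_nil, add_zero, zero_add] at h0 hle0
  have hbal : d.count E + reach v (a.count N) = reach v (a.count N + d.count N) := by
    have h1 := hhoriz d List.prefix_rfl
    have h2 := hle d List.prefix_rfl
    omega
  -- The distance along `d` never drops below its initial value: only an east step lowers it, by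
  -- one, and before such a step it is strictly larger, since `p'` is the first return.
  have hsafe : Safe (reach v) (0 + a.count N) 0 d := by
    rw [zero_add]
    intro w
    induction w using List.reverseRecOn with
    | nil => simp
    | append_singleton w x ih =>
      intro hw
      have hw0 : w <+: d := (List.prefix_append _ _).trans hw
      have ih := ih hw0
      cases x with
      | N =>
        have := hR (show a.count N + w.count N ≤ a.count N + (w.count N + 1) by omega)
        simp
        omega
      | E =>
        have hw1 : w ≠ [] := by
          rintro rfl
          obtain ⟨d, rfl⟩ := hN
          simp at hw
        have hw2 : w ≠ d := by
          rintro rfl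
          have := hw.length_le
          simp at this
        have h1 := hfirst w hw0 hw1 hw2
        have h2 := hle w hw0
        rw [h0, hhoriz w hw0] at h1
        simp
        omega
  have hapre : a <+: u.1 := by rw [hu]; simp
  obtain ⟨i, s, hs⟩ : ∃ i s, stack (reach v) 0 (initialStack v) a = i :: s := by
    refine List.exists_cons_of_ne_nil fun h => ?_
    have := u.length_stack hapre
    rw [h] at this
    simp at this
    omega
  have := bracket_switch hR (c := c) hs hsafe (by simpa using hbal)
  rw [bracketVector, bracketVector, hu, ht, this]
  exact le_self_add

/-- Switch the east step that closes the smallest column `i` where the vectors differ. Minimality of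
`i` and laminarity of `b` force a north step after it; laminarity also prevents the raised entry
from overshooting `b i`. -/
theorem exists_switch_of_lt {u : Tam v} {b : ℕ → ℕ} (hb : IsBracketVector v b)
    (hle : bracketVector u ≤ b) (hne : bracketVector u ≠ b) :
    ∃ t : Tam v, Switch v u.1 t.1 ∧ bracketVector t ≤ b ∧
      ∃ i < v.count E, bracketVector u i < bracketVector t i := by
  have hR := reach_mono v
  have hex : ∃ i, bracketVector u i < b i := by
    by_contra! h
    exact hne (hle.antisymm h)
  classical
  obtain ⟨i, hi, hmin⟩ : ∃ i, bracketVector u i < b i ∧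
      ∀ j < i, bracketVector u j = b j :=
    ⟨Nat.find hex, Nat.find_spec hex,
      fun j hj => (hle j).antisymm (not_lt.1 (Nat.find_min hex hj))⟩
  have him : i < v.count E := by
    by_contra! h
    rw [hb.eq_zero i h] at hi
    omega
  obtain ⟨a, r, s, hau, has, hai⟩ := exists_closing_step hR isStack_initialStack u.safe
    u.stack_eq_nil (u.available him)
  change bracketVector u i = _ at hai
  rw [zero_add] at hai
  have hbi := hb.le_count i
  have hNn := u.count_N
  have hEn := u.count_E
  rw [hau] at hNn hEn
  simp only [List.count_append, List.count_cons_self, ne_eq, reduceCtorEq, not_false_eq_true,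
    List.count_cons_of_ne] at hNn hEn
  -- The path cannot end here, because `b i` is a larger height that v still reaches. A second east
  -- step would close some `k < i` at the same height, where `b k` agrees with u; laminarity of `b`
  -- would then give `b i ≤ b k`, contradicting the choice of `i`.
  obtain ⟨r, rfl⟩ : ∃ r', r = N :: r' := by
    cases r with
    | nil => simp at hNn; omega
    | cons x r =>
      cases x with
      | N => exact ⟨r, rfl⟩
      | E =>
        exfalso
        have hpre : a ++ [E] <+: u.1 := by rw [hau]; simp
        have hpre2 : a ++ [E, E] <+: u.1 := by rw [hau]; simp
        have hst : stack (reach v) 0 (initialStack v) (a ++ [E]) = s := by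
          simp [stack_append, has, stack]
        have hst2 := isStack_stack hR isStack_initialStack
          (u.safe.of_prefix ((List.prefix_append a _).trans hpre))
        rw [has] at hst2
        obtain ⟨k, s, rfl⟩ : ∃ k s', s = k :: s' := by
          refine List.exists_cons_of_ne_nil fun h => ?_
          have h1 := u.length_stack hpre
          have h2 := (pathAbove_iff.1 u.2.2 _ hpre2).2
          rw [hst, h] at h1
          simp at h1 h2
          omega
        have hki : k < i := hst2.lt_head (by simp)
        have hilt := hst2.2 i (by simp)
        rw [zero_add] at hilt
        have hk : a.count N ≤ bracketVector u k ∧ bracketVector u k ≤ a.count N := by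
          have h1 := bracket_le hR isStack_initialStack (u.safe.of_prefix hpre2) k
          have hst3 : stack (reach v) 0 (initialStack v) (a ++ [E, E]) = s := by
            simp [stack_append, has, stack]
          have h2 : Safe (reach v) (0 + (a ++ [E, E]).count N) s.length r := by
            have h3 : u.1 = (a ++ [E, E]) ++ r := by simp [hau]
            have h4 := u.safe
            rw [h3] at h4
            simpa only [hst3] using h4.right hR isStack_initialStack
          have hk2 := hst2.east.2 k List.mem_cons_self
          have h3 : bracket (reach v) (a.count N) s r k = 0 := by
            refine bracket_eq_zero hR (y := a.count N) ?_ (by simpa using h2)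
              hst2.east.head_notMem (Or.inl (by simpa using hk2))
            simpa using hst2.east.east
          have h4 : bracketVector u k =
              bracket (reach v) 0 (initialStack v) a k + a.count N := by
            rw [bracketVector, hau, bracket_append]
            simp [has, bracket, h3, hki.ne]
          have h5 : bracket (reach v) 0 (initialStack v) (a ++ [E, E]) k =
              bracket (reach v) 0 (initialStack v) a k + a.count N := by
            rw [bracket_append]
            simp [has, bracket, hki.ne]
          rw [h5] at h1
          simp at h1
          omega
        have h1 := hmin k hki
        have h2 := hb.laminar k i hki him
        rw [← h1, show bracketVector u k = a.count N by omega] at h2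
        have := h2 hilt
        omega
  have hapre : a <+: u.1 := by rw [hau]; simp
  have hla := u.length_stack hapre
  rw [has, List.length_cons] at hla
  -- A return exists because the path ends at distance zero from v.
  obtain ⟨d, c, hdc, hNd, hbal, hlt⟩ := exists_first_return hR (y := a.count N) (r := r) (by
    rw [hNn, reach_count]
    omega)
  have huE : u.1 = a ++ [E] ++ d ++ c := by simp [hau, hdc]
  have hmem := mem_tam_of_switch (a := a) (d := d) (c := c) (by rw [← huE]; exact u.2)
  let t : Tam v := ⟨a ++ d ++ [E] ++ c, hmem⟩
  have hsafe : Safe (reach v) (0 + a.count N) 0 d := by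
    intro w hw
    rw [zero_add, zero_add]
    by_cases hw1 : w = []
    · simp [hw1]
    by_cases hw2 : w = d
    · rw [hw2, hbal]
    exact (hlt w hw hw1 hw2).le
  have hvec : bracketVector t = bracketVector u + Pi.single i (d.count N) := by
    rw [bracketVector, bracketVector, huE]
    exact bracket_switch hR has hsafe (by simpa using hbal)
  have hdpos : 0 < d.count N := by
    obtain ⟨d, rfl⟩ := hNd
    simp
  have hhoriz : ∀ w, w <+: d → horiz v (endpoint (a ++ [E] ++ w)) =
      reach v (a.count N + w.count N) - (w.count E + a.count E + 1) := by
    intro w hw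
    rw [u.horiz_eq (by rw [huE]; simpa using hw.trans (List.prefix_append _ _))]
    simp
    omega
  have h0 := hhoriz [] List.nil_prefix
  simp only [List.append_nil, List.count_nil, add_zero, zero_add] at h0
  refine ⟨t, ⟨a, d, c, huE, rfl, hNd, ?_, ?_⟩, ?_, i, him, ?_⟩
  · rw [hhoriz d List.prefix_rfl, h0]
    omega
  · intro w hw hw1 hw2
    have := hlt w hw hw1 hw2
    rw [hhoriz w hw, h0]
    omega
  · intro j
    rw [hvec, Pi.add_apply]
    by_cases hji : j = i
    swap
    · rw [Pi.single_eq_of_ne hji, add_zero]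
      exact hle j
    subst hji
    rw [Pi.single_eq_same, hai]
    -- If the new entry exceeded `b j`, the last point of `d` at height `b j` would be an interior
    -- one, so by the first-return property some column `k > j` opened in `d` is still open there.
    -- The next step is north, so u closes `k` above height `b j`, whence `b k > b j`, against
    -- laminarity of `b`.
    refine Nat.le_of_not_lt fun hbj => ?_
    obtain ⟨w, hwN, hw⟩ := exists_prefix_append_north (d := d) (k := b j - a.count N) (by omega)
    have hwd : w <+: d := (List.prefix_append _ _).trans hwN
    have hyw : a.count N + w.count N = b j := by omega
    have hw1 : w ≠ [] := by
      rintro rfl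
      simp at hw
      omega
    have hw2 : w ≠ d := by
      rintro rfl
      have := hwN.length_le
      simp at this
    have hlw := hlt w hwd hw1 hw2
    rw [hyw] at hlw
    have hnil : IsStack (reach v) (a.count N) [] := ⟨List.Pairwise.nil, by simp⟩
    have hsw : Safe (reach v) (a.count N) ([] : List ℕ).length w := by
      simpa using hsafe.of_prefix hwd
    have hlT := length_stack hR hnil hsw
    rw [hyw, List.length_nil] at hlT
    obtain ⟨k, T, hT⟩ : ∃ k T, stack (reach v) (a.count N) [] w = k :: T := by
      refine List.exists_cons_of_ne_nil fun h => ?_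
      rw [h, List.length_nil] at hlT
      omega
    have hjk : j < k := by
      have h1 : a ++ w <+: t.1 := by
        simpa [t] using hwd.trans (List.prefix_append _ _)
      have h2 := isStack_stack hR isStack_initialStack (t.safe.of_prefix h1)
      simp only [stack_append, has, zero_add] at h2
      have h3 := (stack_bracket_append_stack hR hnil hsw (j :: s)).1
      rw [List.nil_append, hT] at h3
      rw [h3] at h2
      exact h2.lt_head (i := j) (by simp)
    have hkR : k < reach v (b j) := by
      have h1 := isStack_stack hR hnil hsw
      rw [hT, hyw] at h1
      exact h1.2 k List.mem_cons_self
    obtain ⟨r', hr'⟩ : ∃ r', u.1 = (a ++ [E] ++ w) ++ N :: r' := by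
      obtain ⟨r', rfl⟩ := hwN
      exact ⟨r' ++ c, by simp [huE]⟩
    have hst : stack (reach v) 0 (initialStack v) (a ++ [E] ++ w) = k :: (T ++ s) := by
      have h3 := (stack_bracket_append_stack hR hnil hsw s).1
      rw [List.nil_append, hT] at h3
      simpa [stack_append, has, stack] using h3
    have hcN : 0 + (a ++ [E] ++ w).count N = b j := by
      simp
      omega
    have hsafe' := u.safe
    have hnil' := u.stack_eq_nil
    rw [hr'] at hsafe' hnil'
    have hst' := isStack_stack hR isStack_initialStack
      (hsafe'.of_prefix (List.prefix_append _ _))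
    have hsafe2 := hsafe'.right hR isStack_initialStack
    rw [hst, hcN] at hsafe2 hst'
    rw [stack_append, hst, hcN] at hnil'
    have h1 := (le_bracket hR (hst'.north hR) (hsafe2.north hR) hnil' (j := k) (by simp)).1
    have h2 : b j + 1 ≤ bracketVector u k := by
      rw [bracketVector, hr', bracket_append, hst, hcN, Pi.add_apply]
      exact h1.trans (Nat.le_add_left _ _)
    have h3 : bracketVector u k ≤ b k := hle k
    have h4 := hb.laminar j k hjk (hkR.trans_le (reach_le_count v _)) hkR
    omega
  · rw [hvec]
    simpa using hdpos

/-- Iterates `exists_switch_of_lt`; each switch strictly decreases the total gap between the two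
vectors, which is the induction measure. -/
theorem exists_tamLE_of_le {u : Tam v} {b : ℕ → ℕ} (hb : IsBracketVector v b)
    (hle : bracketVector u ≤ b) : ∃ t, TamLE v u t ∧ bracketVector t = b := by
  induction hm : ∑ j ∈ Finset.range (v.count E), (b j - bracketVector u j)
    using Nat.strong_induction_on generalizing u with
  | _ m ih =>
    by_cases heq : bracketVector u = b
    · exact ⟨u, Relation.ReflTransGen.refl, heq⟩
    obtain ⟨t, hut, htb, i, hi, hlt⟩ := exists_switch_of_lt hb hle heq
    have hmono := bracketVector_le_of_switch hut
    obtain ⟨t', h1, h2⟩ := ih _ (by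
      rw [← hm]
      refine Finset.sum_lt_sum (fun j _ => Nat.sub_le_sub_left (hmono j) _)
        ⟨i, Finset.mem_range.2 hi, ?_⟩
      have : bracketVector t i ≤ b i := htb i
      omega) htb rfl
    exact ⟨t', Relation.ReflTransGen.head hut h1, h2⟩

theorem exists_bracketVector_eq {b : ℕ → ℕ} (hb : IsBracketVector v b) :
    ∃ u : Tam v, bracketVector u = b :=
  (exists_tamLE_of_le hb (bracketVector_bot_le hb)).imp fun _ h => h.2

theorem tamLE_iff {u t : Tam v} : TamLE v u t ↔ bracketVector u ≤ bracketVector t := by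
  constructor
  · intro h
    induction h with
    | refl => exact le_rfl
    | tail _ h ih => exact ih.trans (bracketVector_le_of_switch h)
  · intro h
    obtain ⟨t', h1, h2⟩ := exists_tamLE_of_le (isBracketVector_bracketVector t) h
    rwa [← bracketVector_injective h2]

/-! ### Meets and joins -/

/-- An infimum of natural numbers is attained. For laminarity, apply the condition to the member
attaining the infimum at `i`. -/
theorem IsBracketVector.iInf {ι : Type*} [Nonempty ι] {f : ι → ℕ → ℕ}
    (hf : ∀ k, IsBracketVector v (f k)) : IsBracketVector v fun j => ⨅ k, f k j := by
  have hle : ∀ k j, ⨅ k, f k j ≤ f k j := fun k j => ciInf_le (OrderBot.bddBelow _) k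
  have hatt : ∀ j, ∃ k, f k j = ⨅ k, f k j := fun j => Nat.sInf_mem (Set.range_nonempty _)
  refine ⟨fun j hj => ?_, fun j => ?_, fun j hj => ?_, fun i j hij hj h => ?_⟩
  · obtain ⟨k, hk⟩ := hatt j
    rw [← hk, (hf k).eq_zero j hj]
  · obtain ⟨k, hk⟩ := hatt j
    rw [← hk]
    exact (hf k).le_count j
  · obtain ⟨k, hk⟩ := hatt j
    rw [← hk]
    exact (hf k).lt_reach j hj
  · obtain ⟨k, hk⟩ := hatt i
    rw [← hk] at h ⊢
    exact (hle k j).trans ((hf k).laminar i j hij hj h)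

theorem isBracketVector_top :
    IsBracketVector v fun j => if j < v.count E then v.count N else 0 := by
  refine ⟨fun j hj => by simp [hj], fun j => by split_ifs <;> simp, fun j hj => ?_,
    fun i j hij hj _ => ?_⟩
  · simp [hj, reach_count]
  · simp [hj, hij.trans hj]

/-- Nonempty families in `Tam v` have a greatest lower bound. -/
theorem exists_isGLB {ι : Type*} [Nonempty ι] (f : ι → Tam v) :
    ∃ u : Tam v, (∀ k, TamLE v u (f k)) ∧ ∀ t, (∀ k, TamLE v t (f k)) → TamLE v t u := by
  obtain ⟨u, hu⟩ := exists_bracketVector_eq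
    (IsBracketVector.iInf fun k => isBracketVector_bracketVector (f k))
  simp only [tamLE_iff]
  exact ⟨u, by
    rw [hu]
    exact fun k j => ciInf_le (OrderBot.bddBelow _) k, by
    rw [hu]
    exact fun t ht j => le_ciInf fun k => ht k j⟩

theorem exists_isLUB (a b : Tam v) :
    ∃ u, TamLE v a u ∧ TamLE v b u ∧ ∀ t, TamLE v a t → TamLE v b t → TamLE v u t := by
  obtain ⟨top, htop⟩ := exists_bracketVector_eq (v := v) isBracketVector_top
  have hle : ∀ c : Tam v, TamLE v c top := by
    intro c
    rw [tamLE_iff, htop]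
    intro j
    have hc := isBracketVector_bracketVector c
    by_cases hj : j < v.count E
    · simpa [hj] using hc.le_count j
    · simpa [hj] using hc.eq_zero j (not_lt.1 hj)
  -- The join is the meet of all common upper bounds; the top element makes this family nonempty, as
  -- `exists_isGLB` requires.
  have : Nonempty {t : Tam v // TamLE v a t ∧ TamLE v b t} := ⟨top, hle a, hle b⟩
  obtain ⟨u, h1, h2⟩ := exists_isGLB fun t : {t : Tam v // TamLE v a t ∧ TamLE v b t} => t.1
  exact ⟨u, h2 a fun t => t.2.1, h2 b fun t => t.2.2, fun t ha hb => h1 ⟨t, ha, hb⟩⟩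

/-- The lattice structure of `Tam v`. -/
@[reducible]
noncomputable def tamLattice (v : LatticePath) : Lattice (Tam v) where
  le := TamLE v
  le_refl _ := Relation.ReflTransGen.refl
  le_trans _ _ _ := Relation.ReflTransGen.trans
  le_antisymm _ _ h1 h2 :=
    bracketVector_injective ((tamLE_iff.1 h1).antisymm (tamLE_iff.1 h2))
  sup a b := (exists_isLUB a b).choose
  le_sup_left a b := (exists_isLUB a b).choose_spec.1
  le_sup_right a b := (exists_isLUB a b).choose_spec.2.1
  sup_le a b c := (exists_isLUB a b).choose_spec.2.2 c
  inf a b := (exists_isGLB fun k : Bool => cond k a b).choose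
  inf_le_left a b := (exists_isGLB fun k : Bool => cond k a b).choose_spec.1 true
  inf_le_right a b := (exists_isGLB fun k : Bool => cond k a b).choose_spec.1 false
  le_inf a b c h1 h2 := (exists_isGLB fun k : Bool => cond k b c).choose_spec.2 a fun k => by
    cases k
    · exact h2
    · exact h1

end Tam

end LatticePath

/-- For every finite lattice path `v`, the relation `TamLE v` is a partial order on `Tam(v)`,
and it makes `Tam(v)` a lattice. -/
theorem theorem1 (v : LatticePath) :
    ∃ L : Lattice (LatticePath.Tam v),
      ∀ a b : LatticePath.Tam v, L.le a b ↔ LatticePath.TamLE v a b :=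
  ⟨LatticePath.tamLattice v, fun _ _ => Iff.rfl⟩
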